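/- Let $M$ be a connected smooth manifold of dimension $n$ (Hausdorff and second countable), and let $F$ be a Finsler metric on $M$: a function $F : TM\setminus\{0\}\to(0,\infty)$ that is smooth, satisfies $F(\lambda y)=\lambda F(y)$ for all $\lambda>0$, and whose fundamental tensor $g_{ij}=\tfrac12[F^2]_{y^iy^j}$ is positive definite at every $y\neq 0$ in every standard local coordinate system $(x^i,y^j)$ of $TM$. (At zero vectors put $F=0$.) Suppose that $(M,F)$ is homogeneous, that is, the group of isometries of $(M,F)$ (the diffeomorphisms $f$ of $M$ with $F\circ df=F$) acts transitively on $M$. In standard local coordinates $(x^i,y^j)$ of $TM$ let $$\tau(x,y)=\ln\frac{\sqrt{\det(g_{pq}(x,y))}}{\sigma(x)},\qquad \sigma(x)=\frac{\mathrm{Vol}(B^n)}{\mathrm{Vol}\{(y^i)\in\mathbb R^n : F(x,y^i\partial_{x^i})<1\}}$$ be the distortion ($B^n$ is the Euclidean unit ball and $\mathrm{Vol}$ is Lebesgue measure), let $$G=y^i\partial_{x^i}-\tfrac12 g^{il}\big([F^2]_{x^jy^l}y^j-[F^2]_{x^l}\big)\partial_{y^i}$$ be the geodesic spray, and for $y\neq0$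 let the S-curvature $S(x,y)$ be the derivative of $\tau$ at $(x,y)$ in the direction $G(x,y)$, i.e. along the geodesic with initial vector $y$; it does not depend on the choice of local coordinates. Then $F$ has isotropic S-curvature, i.e. there is a function $c:M\to\mathbb R$ with $S(x,y)=(n+1)\,c(x)\,F(x,y)$ for all $x\in M$ and all $0\neq y\in T_xM$, if and only if its S-curvature vanishes, i.e. $S(x,y)=0$ for all $x\in M$ and all $0\neq y\in T_xM$. -/

import Mathlib

open scoped Manifold ContDiff

noncomputable section

namespace Finsler

/-- The model space `ℝⁿ` with its Euclidean structure and Lebesgue measure. -/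
abbrev Rn (n : ℕ) : Type := EuclideanSpace ℝ (Fin n)

/-- The `i`-th standard basis vector of `ℝⁿ`. -/
def stdVec {n : ℕ} (i : Fin n) : Rn n := EuclideanSpace.single i 1

/-- The partial derivative `∂f/∂xⁱ` of a function `f (x, y)` on `ℝⁿ × ℝⁿ`. -/
def partialX {n : ℕ} (i : Fin n) (f : Rn n × Rn n → ℝ) : Rn n × Rn n → ℝ :=
  fun z => lineDeriv ℝ f z (stdVec i, 0)

/-- The partial derivative `∂f/∂yⁱ` of a function `f (x, y)` on `ℝⁿ × ℝⁿ`. -/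
def partialY {n : ℕ} (i : Fin n) (f : Rn n × Rn n → ℝ) : Rn n × Rn n → ℝ :=
  fun z => lineDeriv ℝ f z (0, stdVec i)

section Coordinates

variable {n : ℕ} {M : Type*} [TopologicalSpace M] [ChartedSpace (Rn n) M]

/-- The standard local coordinates of `TM` induced by a chart `e` of `M`: the pair `(a, y)` stands
for the tangent vector `yⁱ ∂/∂xⁱ` at the point with coordinates `a`, that is, for the image of `y`
under the differential at `a` of the inverse chart. -/
def coordVec (e : OpenPartialHomeomorph M (Rn n)) (z : Rn n × Rn n) : TangentBundle (𝓡 n) M :=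
  ⟨e.symm z.1, mfderiv (𝓡 n) (𝓡 n) e.symm z.1 z.2⟩

/-- The function `F²` in the local coordinates `(x, y)`. -/
def sqCoord (F : TangentBundle (𝓡 n) M → ℝ) (e : OpenPartialHomeomorph M (Rn n)) :
    Rn n × Rn n → ℝ :=
  fun z => F (coordVec e z) ^ 2

/-- The fundamental tensor `g_{ij} = ½ [F²]_{yⁱ yʲ}` in the local coordinates `(x, y)`. -/
def fundamentalMatrix (F : TangentBundle (𝓡 n) M → ℝ) (e : OpenPartialHomeomorph M (Rn n))
    (z : Rn n × Rn n) : Matrix (Fin n) (Fin n) ℝ :=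
  Matrix.of fun i j => (1 / 2 : ℝ) * partialY j (partialY i (sqCoord F e)) z

/-- The density `σ(x) = Vol(Bⁿ) / Vol{(yⁱ) ∈ ℝⁿ | F(x, yⁱ ∂/∂xⁱ) < 1}` of the Busemann–Hausdorff
volume in local coordinates. -/
def busemannDensity (F : TangentBundle (𝓡 n) M → ℝ) (e : OpenPartialHomeomorph M (Rn n))
    (a : Rn n) : ℝ :=
  MeasureTheory.volume.real (Metric.ball (0 : Rn n) 1) /
    MeasureTheory.volume.real {y : Rn n | F (coordVec e (a, y)) < 1}

/-- The distortion `τ = ln (√det(g_{pq}) / σ(x))` in the local coordinates `(x, y)`. -/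
def distortion (F : TangentBundle (𝓡 n) M → ℝ) (e : OpenPartialHomeomorph M (Rn n))
    (z : Rn n × Rn n) : ℝ :=
  Real.log (√(fundamentalMatrix F e z).det / busemannDensity F e z.1)

/-- The geodesic spray
`G = yⁱ ∂/∂xⁱ - ½ g^{il} ([F²]_{xʲ yˡ} yʲ - [F²]_{xˡ}) ∂/∂yⁱ` in the local coordinates `(x, y)`. -/
def spray (F : TangentBundle (𝓡 n) M → ℝ) (e : OpenPartialHomeomorph M (Rn n))
    (z : Rn n × Rn n) : Rn n × Rn n :=
  (z.2, WithLp.toLp 2 fun i =>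
    -(1 / 2 : ℝ) * ∑ l, (fundamentalMatrix F e z)⁻¹ i l *
      (∑ j, partialY l (partialX j (sqCoord F e)) z * z.2 j - partialX l (sqCoord F e) z))

/-- The derivative of the distortion in the direction of the geodesic spray, in the local
coordinates `(x, y)`. -/
def sCurvatureCoord (F : TangentBundle (𝓡 n) M → ℝ) (e : OpenPartialHomeomorph M (Rn n))
    (z : Rn n × Rn n) : ℝ :=
  lineDeriv ℝ (distortion F e) z (spray F e z)

end Coordinates

section Metric

variable {n : ℕ} {M : Type*} [TopologicalSpace M] [ChartedSpace (Rn n) M]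
  [IsManifold (𝓡 n) ∞ M]

variable (n M) in
/-- A Finsler metric on `M`: a positive function on the nonzero tangent vectors, extended by `0` to
the zero vectors, which is smooth off the zero section, positively homogeneous of degree one, and
whose fundamental tensor is positive definite in every local coordinate system. -/
structure FinslerMetric where
  toFun : TangentBundle (𝓡 n) M → ℝ
  map_zero' : ∀ x : M, toFun ⟨x, 0⟩ = 0
  pos' : ∀ v : TangentBundle (𝓡 n) M, v.2 ≠ 0 → 0 < toFun v
  smooth' : ContMDiffOn (𝓡 n).tangent 𝓘(ℝ, ℝ) ∞ toFun {v | v.2 ≠ 0}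
  homog' : ∀ (x : M) (y : TangentSpace (𝓡 n) x) (r : ℝ), y ≠ 0 → 0 < r →
    toFun ⟨x, r • y⟩ = r * toFun ⟨x, y⟩
  posDef' : ∀ e ∈ IsManifold.maximalAtlas (𝓡 n) ∞ M, ∀ a ∈ e.target, ∀ y : Rn n, y ≠ 0 →
    (fundamentalMatrix toFun e (a, y)).PosDef

instance : CoeFun (FinslerMetric n M) (fun _ => TangentBundle (𝓡 n) M → ℝ) :=
  ⟨FinslerMetric.toFun⟩

/-- A diffeomorphism of `M` is an isometry of `(M, F)` if its differential preserves `F`. -/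
def FinslerMetric.IsIsometry (F : FinslerMetric n M) (f : M ≃ₘ^∞⟮𝓡 n, 𝓡 n⟯ M) : Prop :=
  ∀ v : TangentBundle (𝓡 n) M, F (tangentMap (𝓡 n) (𝓡 n) f v) = F v

/-- `(M, F)` is homogeneous if its isometries act transitively on `M`. -/
def FinslerMetric.IsHomogeneous (F : FinslerMetric n M) : Prop :=
  ∀ x x' : M, ∃ f : M ≃ₘ^∞⟮𝓡 n, 𝓡 n⟯ M, F.IsIsometry f ∧ f x = x'

/-- The S-curvature `S(x, y)` of a nonzero tangent vector `(x, y)`: the derivative at `(x, y)` of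
the distortion in the direction of the geodesic spray. The distortion and the spray do not depend
on the local coordinates; they are computed here in the preferred chart at `x`, in which `TM` has
the coordinates given by the induced chart of the tangent bundle. -/
def FinslerMetric.sCurvature (F : FinslerMetric n M) (v : TangentBundle (𝓡 n) M) : ℝ :=
  let e := chartAt (Rn n) v.proj
  sCurvatureCoord F e (e v.proj, mfderiv (𝓡 n) (𝓡 n) e v.proj v.2)

/-- `S = (n + 1) c(x) F` on the nonzero tangent vectors, for some function `c` on `M`. -/
def FinslerMetric.HasIsotropicSCurvature (F : FinslerMetric n M) : Prop :=
  ∃ c : M → ℝ, ∀ v : TangentBundle (𝓡 n) M, v.2 ≠ 0 →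
    F.sCurvature v = ((n : ℝ) + 1) * c v.proj * F v

/-- `S = 0` on the nonzero tangent vectors. -/
def FinslerMetric.HasVanishingSCurvature (F : FinslerMetric n M) : Prop :=
  ∀ v : TangentBundle (𝓡 n) M, v.2 ≠ 0 → F.sCurvature v = 0

end Metric

end Finsler

end

/-!
Write `τ` for the distortion. Two properties of `τ` decide the matter. First, `τ` is homogeneous of
degree zero along the fibres of `TM` (`FinslerMetric.distortion_smul`), so on each nonzero tangent
space it attains a maximum, namely its maximum over a compact sphere
(`FinslerMetric.exists_forall_distortion_le`). Second, `τ` depends only on the restriction of `F` to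
a fibre and is invariant under linear isomorphisms `A` of fibres which preserve `F`: both `√det g`
and `σ` are multiplied by `|det A|` (`distortion_of_linear`). In particular `τ` is invariant under
the differentials of isometries.

On a homogeneous space, therefore, a maximum point `y` of `τ` on one tangent space is a maximum
point of `τ` on the whole of `TM` off the zero section. Hence the derivative of `τ` at `y` in every
direction vanishes, and in particular `S (x, y) = 0`
(`FinslerMetric.IsHomogeneous.exists_sCurvature_eq_zero`). If `S = (n + 1) c F`, then
`(n + 1) c (x) F (x, y) = 0` with `F (x, y) > 0`, so `(n + 1) c (x) = 0` at every point `x` and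
`S = 0`. No completeness or smoothness of geodesics enters.
-/

namespace Finsler

/-! ### Half the Hessian matrix of a function on `ℝⁿ` -/

/-- The matrix `½ u_{yⁱ yʲ}` of a function `u` on `ℝⁿ`, formed from iterated directional derivatives
like `fundamentalMatrix`, which is its value at the restriction of `F²` to a fibre of `TM`. -/
noncomputable def halfHessian {n : ℕ} (u : Rn n → ℝ) (w : Rn n) : Matrix (Fin n) (Fin n) ℝ :=
  Matrix.of fun i j =>
    (1 / 2 : ℝ) * lineDeriv ℝ (fun y => lineDeriv ℝ u y (stdVec i)) w (stdVec j)

section HalfHessian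

variable {n : ℕ}

lemma halfHessian_apply {u : Rn n → ℝ} {w : Rn n} (hu : ContDiffAt ℝ 2 u w) (i j : Fin n) :
    halfHessian u w i j =
      (1 / 2 : ℝ) * fderiv ℝ (fderiv ℝ u) w (stdVec j) (stdVec i) := by
  have hev : (fun y => lineDeriv ℝ u y (stdVec i)) =ᶠ[nhds w]
      fun y => fderiv ℝ u y (stdVec i) := by
    filter_upwards [hu.eventually (by simp)] with y hy
    exact (hy.differentiableAt (by simp)).lineDeriv_eq_fderiv
  have hd : DifferentiableAt ℝ (fderiv ℝ u) w :=
    (hu.fderiv_right (m := 1) (by norm_num)).differentiableAt (by simp)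
  have hd' : HasFDerivAt (fun y => fderiv ℝ u y (stdVec i))
      ((fderiv ℝ (fderiv ℝ u) w).flip (stdVec i)) w :=
    by simpa using hd.hasFDerivAt.clm_apply (hasFDerivAt_const (stdVec i) w)
  simp only [halfHessian, Matrix.of_apply]
  rw [hev.lineDeriv_eq, hd'.differentiableAt.lineDeriv_eq_fderiv, hd'.fderiv]
  rfl

lemma continuousAt_halfHessian {u : Rn n → ℝ} {w : Rn n} (hu : ContDiffAt ℝ 2 u w) :
    ContinuousAt (halfHessian u) w := by
  have hc : ContinuousAt (fderiv ℝ (fderiv ℝ u)) w :=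
    ((hu.fderiv_right (m := 1) (by norm_num)).fderiv_right (m := 0) (by norm_num)).continuousAt
  refine continuousAt_pi.2 fun i => continuousAt_pi.2 fun j => ?_
  have hev : (fun y => halfHessian u y i j) =ᶠ[nhds w]
      fun y => (1 / 2 : ℝ) * fderiv ℝ (fderiv ℝ u) y (stdVec j) (stdVec i) := by
    filter_upwards [hu.eventually (by simp)] with y hy
    exact halfHessian_apply hy i j
  refine ContinuousAt.congr ?_ hev.symm
  fun_prop

/-- The change of variables formula for the determinant of the Hessian. -/
lemma det_halfHessian_comp (A : Rn n →L[ℝ] Rn n) {u : Rn n → ℝ} {w : Rn n}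
    (hu : ContDiffAt ℝ 2 u (A w)) :
    (halfHessian (fun y => u (A y)) w).det =
      (LinearMap.det (A : Rn n →ₗ[ℝ] Rn n)) ^ 2 * (halfHessian u (A w)).det := by
  set b := (EuclideanSpace.basisFun (Fin n) ℝ).toBasis
  set P := LinearMap.toMatrix b b (A : Rn n →ₗ[ℝ] Rn n)
  have hb : ∀ i, b i = stdVec i := fun i => by simp [b, stdVec]
  have hA : ∀ i, A (stdVec i) = ∑ k, P k i • stdVec k := fun i => by
    have := b.sum_repr (A (stdVec i))
    simp only [hb] at this
    rw [← this]
    refine Finset.sum_congr rfl fun k _ => ?_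
    simp only [P, LinearMap.toMatrix_apply, hb]
    rfl
  have hl : ∀ y v, lineDeriv ℝ (fun y => u (A y)) y v = lineDeriv ℝ u (A y) (A v) := fun y v => by
    simp [lineDeriv]
  have hmat : halfHessian (fun y => u (A y)) w = P.transpose * halfHessian u (A w) * P := by
    ext i j
    have huA : ContDiffAt ℝ 2 (fun y => u (A y)) w :=
      ContDiffAt.comp w hu A.contDiff.contDiffAt
    have hfd : fderiv ℝ (fderiv ℝ fun y => u (A y)) w (stdVec j) (stdVec i) =
        fderiv ℝ (fderiv ℝ u) (A w) (A (stdVec j)) (A (stdVec i)) := by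
      have hev : fderiv ℝ (fun y => u (A y)) =ᶠ[nhds w] fun y => (fderiv ℝ u (A y)).comp A := by
        filter_upwards [A.continuous.continuousAt.eventually (hu.eventually (by simp))] with y hy
        have := (hy.differentiableAt (by simp)).hasFDerivAt.comp y A.hasFDerivAt
        exact this.fderiv
      have hd : DifferentiableAt ℝ (fderiv ℝ u) (A w) :=
        (hu.fderiv_right (m := 1) (by norm_num)).differentiableAt (by simp)
      have h2 := (hd.hasFDerivAt.comp w A.hasFDerivAt).clm_comp (hasFDerivAt_const A w)
      rw [hev.fderiv_eq]
      erw [h2.fderiv]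
      simp
    rw [halfHessian_apply huA, hfd, hA i, hA j, Matrix.mul_assoc]
    simp only [Matrix.mul_apply, Matrix.transpose_apply, halfHessian_apply hu, map_sum, map_smul,
      sum_apply, smul_apply, smul_eq_mul, Finset.mul_sum]
    refine Finset.sum_congr rfl fun k _ => Finset.sum_congr rfl fun l _ => ?_
    ring
  rw [hmat, Matrix.det_mul, Matrix.det_mul, Matrix.det_transpose, LinearMap.det_toMatrix]
  ring

/-- The Hessian of a function homogeneous of degree two is homogeneous of degree zero. -/
lemma halfHessian_smul {u : Rn n → ℝ} {r : ℝ} (hr : r ≠ 0) (hu : ∀ y, u (r • y) = r ^ 2 * u y)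
    (w : Rn n) : halfHessian u (r • w) = halfHessian u w := by
  have h1 : ∀ (f : Rn n → ℝ) y v,
      lineDeriv ℝ (fun y => f (r • y)) y v = r * lineDeriv ℝ f (r • y) v := fun f y v => by
    rw [← smul_eq_mul, ← lineDeriv_smul]
    simp [lineDeriv, smul_comm r]
  have h2 : ∀ (f : Rn n → ℝ) (c : ℝ) y v,
      lineDeriv ℝ (fun y => c * f y) y v = c * lineDeriv ℝ f y v := fun f c y v => by
    simp [lineDeriv]
  ext i j
  have e1 : (fun y => r * lineDeriv ℝ u (r • y) (stdVec i)) =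
      fun y => r ^ 2 * lineDeriv ℝ u y (stdVec i) := by
    funext y
    rw [← h1, ← h2]
    simp only [hu]
  have e2 := congrArg (fun f => lineDeriv ℝ f w (stdVec j)) e1
  simp only [h2] at e2
  rw [h1 (fun y => lineDeriv ℝ u y (stdVec i))] at e2
  have : r ^ 2 * halfHessian u (r • w) i j = r ^ 2 * halfHessian u w i j := by
    simp only [halfHessian, Matrix.of_apply]
    linear_combination (1 / 2 : ℝ) * e2
  exact mul_left_cancel₀ (pow_ne_zero 2 hr) this

end HalfHessian

/-! ### The distortion on the fibres of `TM` -/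

section Distortion

variable {n : ℕ} {M : Type*} [TopologicalSpace M] [ChartedSpace (Rn n) M]

lemma fundamentalMatrix_eq_halfHessian (F : TangentBundle (𝓡 n) M → ℝ)
    (e : OpenPartialHomeomorph M (Rn n)) (a w : Rn n) :
    fundamentalMatrix F e (a, w) = halfHessian (fun y => F (coordVec e (a, y)) ^ 2) w := by
  ext i j
  simp [fundamentalMatrix, halfHessian, partialY, lineDeriv, sqCoord]

/-- The Busemann–Hausdorff density transforms like a density under a linear isomorphism of fibres
which preserves `F`. -/
lemma busemannDensity_of_linear {F : TangentBundle (𝓡 n) M → ℝ}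
    {e : OpenPartialHomeomorph M (Rn n)} {a b : Rn n} (A : Rn n ≃L[ℝ] Rn n)
    (hA : ∀ y, F (coordVec e (b, y)) = F (coordVec e (a, A y))) :
    busemannDensity F e b =
      |LinearMap.det (A : Rn n →ₗ[ℝ] Rn n)| * busemannDensity F e a := by
  have hdet : LinearMap.det ((A : Rn n →L[ℝ] Rn n) : Rn n →ₗ[ℝ] Rn n) ≠ 0 :=
    A.toLinearEquiv.isUnit_det'.ne_zero
  have hset : {y : Rn n | F (coordVec e (b, y)) < 1} =
      (A : Rn n →L[ℝ] Rn n) ⁻¹' {y : Rn n | F (coordVec e (a, y)) < 1} := by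
    ext y
    simp [hA]
  have hvol : MeasureTheory.volume.real {y : Rn n | F (coordVec e (b, y)) < 1} =
      |LinearMap.det (A : Rn n →ₗ[ℝ] Rn n)|⁻¹ *
        MeasureTheory.volume.real {y : Rn n | F (coordVec e (a, y)) < 1} := by
    rw [hset, MeasureTheory.Measure.real,
      MeasureTheory.Measure.addHaar_preimage_continuousLinearMap _ hdet, ENNReal.toReal_mul,
      ENNReal.toReal_ofReal (abs_nonneg _), abs_inv, MeasureTheory.Measure.real]
    rfl
  rw [busemannDensity, busemannDensity, hvol, div_mul_eq_div_div, div_inv_eq_mul]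
  ring

/-- The distortion is invariant under linear isomorphisms of fibres which preserve `F`: the factors
`|det A|` of `√det g` and of `σ` cancel. -/
lemma distortion_of_linear {F : TangentBundle (𝓡 n) M → ℝ}
    {e : OpenPartialHomeomorph M (Rn n)} {a b : Rn n} (A : Rn n ≃L[ℝ] Rn n)
    (hA : ∀ y, F (coordVec e (b, y)) = F (coordVec e (a, A y))) {w : Rn n}
    (hw : ContDiffAt ℝ 2 (fun y => F (coordVec e (a, y)) ^ 2) (A w)) :
    distortion F e (b, w) = distortion F e (a, A w) := by
  have hdet : LinearMap.det ((A : Rn n →L[ℝ] Rn n) : Rn n →ₗ[ℝ] Rn n) ≠ 0 :=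
    A.toLinearEquiv.isUnit_det'.ne_zero
  have hcomp := det_halfHessian_comp (A : Rn n →L[ℝ] Rn n)
    (u := fun y => F (coordVec e (a, y)) ^ 2) (w := w) hw
  simp only [ContinuousLinearEquiv.coe_coe] at hcomp
  simp only [distortion]
  rw [busemannDensity_of_linear A hA, fundamentalMatrix_eq_halfHessian,
    fundamentalMatrix_eq_halfHessian]
  simp only [hA]
  rw [hcomp, Real.sqrt_mul (sq_nonneg _), Real.sqrt_sq_eq_abs]
  exact congrArg Real.log (mul_div_mul_left _ _ (abs_ne_zero.2 hdet))

end Distortion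

section Metric

variable {n : ℕ} {M : Type*} [TopologicalSpace M] [ChartedSpace (Rn n) M]
  [IsManifold (𝓡 n) ∞ M]

lemma mfderiv_symm_apply_ne_zero {e : OpenPartialHomeomorph M (Rn n)}
    (he : e ∈ atlas (Rn n) M) {a : Rn n} (ha : a ∈ e.target) {w : Rn n} (hw : w ≠ 0) :
    mfderiv (𝓡 n) (𝓡 n) e.symm a w ≠ 0 := by
  have hd := mdifferentiable_of_mem_atlas (I := 𝓡 n) he
  have hinj := hd.symm.mfderiv_injective (x := a) (by simpa using ha)
  intro h
  exact hw (hinj (h.trans (map_zero _).symm))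

lemma FinslerMetric.contDiffAt_coordVec_sq (F : FinslerMetric n M)
    {e : OpenPartialHomeomorph M (Rn n)} (he : e ∈ atlas (Rn n) M) {a : Rn n}
    (ha : a ∈ e.target) {w : Rn n} (hw : w ≠ 0) :
    ContDiffAt ℝ 2 (fun y => F (coordVec e (a, y)) ^ 2) w := by
  have hF : ContMDiffWithinAt (𝓡 n).tangent 𝓘(ℝ, ℝ) ∞ F.toFun {v | v.2 ≠ 0}
      (coordVec e (a, w)) :=
    F.smooth' _ (mfderiv_symm_apply_ne_zero he ha hw)
  have hv : ContMDiffAt 𝓘(ℝ, Rn n) (𝓡 n).tangent ∞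
      (fun y : Rn n => coordVec (M := M) e (a, y)) w := by
    refine (Bundle.contMDiffAt_totalSpace (IB := 𝓡 n) (E := TangentSpace (𝓡 n) (M := M))).2
      ⟨contMDiffAt_const (c := e.symm a), ?_⟩
    let T := trivializationAt (Rn n) (TangentSpace (𝓡 n) (M := M)) (e.symm a)
    let L : Rn n →L[ℝ] Rn n :=
      (T.continuousLinearMapAt ℝ (e.symm a)).comp (mfderiv (𝓡 n) (𝓡 n) e.symm a)
    have hT : ∀ y : Rn n, (T (coordVec e (a, y))).2 = L y := fun y =>
      (T.continuousLinearMapAt_apply_of_mem (R := ℝ)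
        (FiberBundle.mem_baseSet_trivializationAt' (e.symm a)) _).symm
    exact L.contDiff.contMDiff.contMDiffAt.congr_of_eventuallyEq (Filter.Eventually.of_forall hT)
  have hcomp : ContMDiffWithinAt 𝓘(ℝ, Rn n) 𝓘(ℝ, ℝ) ∞ (fun y : Rn n => F (coordVec e (a, y)))
      {y | y ≠ 0} w :=
    hF.comp w hv.contMDiffWithinAt fun y hy => mfderiv_symm_apply_ne_zero he ha hy
  have h := (hcomp.contMDiffAt (isOpen_ne.mem_nhds hw)).contDiffAt.pow 2
  exact h.of_le (by norm_cast)

/-- The distortion is homogeneous of degree zero along the fibres. -/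
lemma FinslerMetric.distortion_smul (F : FinslerMetric n M) (e : OpenPartialHomeomorph M (Rn n))
    (a w : Rn n) {r : ℝ} (hr : 0 < r) :
    distortion F e (a, r • w) = distortion F e (a, w) := by
  have hu : ∀ y : Rn n, F (coordVec e (a, r • y)) ^ 2 = r ^ 2 * F (coordVec e (a, y)) ^ 2 := by
    intro y
    rw [← mul_pow]
    congr 1
    have hy : coordVec (M := M) e (a, r • y) =
        ⟨e.symm a, r • mfderiv (𝓡 n) (𝓡 n) e.symm a y⟩ :=
      congrArg (fun u : Rn n => (⟨e.symm a, u⟩ : TangentBundle (𝓡 n) M))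
        ((mfderiv (𝓡 n) (𝓡 n) e.symm a).map_smul r y)
    rw [hy]
    by_cases h0 : mfderiv (𝓡 n) (𝓡 n) e.symm a y = 0
    · simp only [coordVec]
      rw [h0, smul_zero, F.map_zero', mul_zero]
    · exact F.homog' _ _ r h0 hr
  simp only [distortion]
  rw [fundamentalMatrix_eq_halfHessian, fundamentalMatrix_eq_halfHessian,
    halfHessian_smul hr.ne' hu]

/-- By homogeneity of degree zero and compactness of the Euclidean unit sphere, the distortion
attains its maximum over the nonzero vectors of each tangent space. -/
lemma FinslerMetric.exists_forall_distortion_le (F : FinslerMetric n M)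
    {e : OpenPartialHomeomorph M (Rn n)} (he : e ∈ atlas (Rn n) M) {a : Rn n}
    (ha : a ∈ e.target) {v : Rn n} (hv : v ≠ 0) :
    ∃ w : Rn n, w ≠ 0 ∧ ∀ y : Rn n, y ≠ 0 → distortion F e (a, y) ≤ distortion F e (a, w) := by
  have hnorm : ∀ y : Rn n, y ≠ 0 → ‖y‖⁻¹ • y ∈ Metric.sphere (0 : Rn n) 1 := fun y hy => by
    simp [norm_smul, inv_mul_cancel₀ (norm_ne_zero_iff.2 hy)]
  have hne : ∀ y ∈ Metric.sphere (0 : Rn n) 1, y ≠ 0 := fun y hy h => by simp [h] at hy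
  have hcont : ContinuousOn (fun y => (fundamentalMatrix F e (a, y)).det)
      (Metric.sphere (0 : Rn n) 1) := fun y hy => by
    simp only [fundamentalMatrix_eq_halfHessian]
    have := continuousAt_halfHessian (F.contDiffAt_coordVec_sq he ha (hne y hy))
    exact (Continuous.matrix_det continuous_id).continuousAt.comp_continuousWithinAt
      this.continuousWithinAt
  obtain ⟨w, hw, hmax⟩ := (isCompact_sphere (0 : Rn n) 1).exists_isMaxOn ⟨_, hnorm v hv⟩ hcont
  refine ⟨w, hne w hw, fun y hy => ?_⟩
  rw [← F.distortion_smul e a y (inv_pos.2 (norm_pos_iff.2 hy))]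
  have hle := hmax (hnorm y hy)
  have hpos : 0 < (fundamentalMatrix F e (a, ‖y‖⁻¹ • y)).det :=
    (F.posDef' e (IsManifold.subset_maximalAtlas he) a ha _ (hne _ (hnorm y hy))).det_pos
  have hσ : 0 ≤ busemannDensity F e a := by unfold busemannDensity; positivity
  simp only [distortion]
  -- `σ` would be `0` only for an indicatrix of infinite volume. Both sides would then be the value
  -- of `Real.log` at `0`, so this case need not be excluded.
  rcases hσ.eq_or_lt with h0 | h0
  · simp [← h0]
  · exact Real.log_le_log (div_pos (Real.sqrt_pos.2 hpos) h0)
      (div_le_div_of_nonneg_right (Real.sqrt_le_sqrt hle) h0.le)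

/-- An isometry carrying the point with coordinates `b` to the point with coordinates `a` induces a
linear isomorphism of the coordinate fibres which preserves `F`. -/
lemma FinslerMetric.IsIsometry.exists_linear {F : FinslerMetric n M}
    {f : M ≃ₘ^∞⟮𝓡 n, 𝓡 n⟯ M} (hf : F.IsIsometry f) {e : OpenPartialHomeomorph M (Rn n)}
    (he : e ∈ atlas (Rn n) M) {a b : Rn n} (ha : a ∈ e.target) (hb : b ∈ e.target)
    (hab : f (e.symm b) = e.symm a) :
    ∃ A : Rn n ≃L[ℝ] Rn n, ∀ y, F (coordVec e (b, y)) = F (coordVec e (a, A y)) := by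
  have hd := mdifferentiable_of_mem_atlas (I := 𝓡 n) he
  let B : Rn n ≃L[ℝ] Rn n := hd.symm.mfderiv (x := b) (by simpa using hb)
  let C : Rn n ≃L[ℝ] Rn n := f.mfderivToContinuousLinearEquiv (by simp) (e.symm b)
  let D : Rn n ≃L[ℝ] Rn n := hd.symm.mfderiv (x := a) (by simpa using ha)
  let A : Rn n ≃L[ℝ] Rn n := (B.trans C).trans D.symm
  refine ⟨A, fun y => ?_⟩
  rw [← hf]
  congr 1
  have hDA : mfderiv (𝓡 n) (𝓡 n) e.symm a (A y) =
      mfderiv (𝓡 n) (𝓡 n) f (e.symm b) (mfderiv (𝓡 n) (𝓡 n) e.symm b y) :=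
    D.apply_symm_apply (C (B y))
  -- All tangent spaces of `M` are by definition `ℝⁿ`, so base points can be exchanged under `⟨·, u⟩`.
  have hgen : ∀ (p q : M) (u : Rn n), p = q →
      (⟨p, u⟩ : TangentBundle (𝓡 n) M) = ⟨q, u⟩ := by
    rintro p _ u rfl
    rfl
  exact (hgen _ _ _ hab).trans
    (congrArg (fun u : Rn n => (⟨e.symm a, u⟩ : TangentBundle (𝓡 n) M)) hDA.symm)

/-! ### Vanishing of the S-curvature at some vector over each point -/

/-- On a homogeneous Finsler space, over each point whose tangent space is nonzero there is a nonzero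
vector of zero S-curvature: a maximum point of the distortion on that tangent space is, by
transitivity of the isometries, a maximum point on all of `TM` off the zero section, so every
directional derivative of the distortion vanishes there, in particular the one along the spray. -/
lemma FinslerMetric.IsHomogeneous.exists_sCurvature_eq_zero {F : FinslerMetric n M}
    (hF : F.IsHomogeneous) (v : TangentBundle (𝓡 n) M) (hv : v.2 ≠ 0) :
    ∃ u : TangentSpace (𝓡 n) v.proj, u ≠ 0 ∧ F.sCurvature ⟨v.proj, u⟩ = 0 := by
  set x := v.proj
  set e := chartAt (Rn n) x
  have he : e ∈ atlas (Rn n) M := chart_mem_atlas _ x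
  have hx : x ∈ e.source := mem_chart_source _ x
  have ha : e x ∈ e.target := e.map_source hx
  have hv' : (v.2 : Rn n) ≠ 0 := hv
  obtain ⟨w, hw, hmax⟩ := F.exists_forall_distortion_le he ha hv'
  have hloc : ∀ z : Rn n × Rn n, z.1 ∈ e.target → z.2 ≠ 0 →
      distortion F e z ≤ distortion F e (e x, w) := by
    rintro ⟨b, y⟩ hb hy
    obtain ⟨f, hf, hfx⟩ := hF (e.symm b) (e.symm (e x))
    obtain ⟨A, hA⟩ := hf.exists_linear he ha hb hfx
    have hAy : A y ≠ 0 := (map_ne_zero_iff A A.injective).2 hy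
    rw [distortion_of_linear A hA (F.contDiffAt_coordVec_sq he ha hAy)]
    exact hmax _ hAy
  refine ⟨mfderiv (𝓡 n) (𝓡 n) e.symm (e x) w, mfderiv_symm_apply_ne_zero he ha hw, ?_⟩
  have hcomp : mfderiv (𝓡 n) (𝓡 n) e x (mfderiv (𝓡 n) (𝓡 n) e.symm (e x) w) = w :=
    ((mdifferentiable_of_mem_atlas (I := 𝓡 n) he).mfderiv hx).apply_symm_apply w
  change sCurvatureCoord F e
    (e x, mfderiv (𝓡 n) (𝓡 n) e x (mfderiv (𝓡 n) (𝓡 n) e.symm (e x) w)) = 0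
  rw [hcomp, sCurvatureCoord, lineDeriv]
  set G := spray F.toFun e (e x, w)
  -- The derivative at a local maximum is `0` also if it is only the default value, so the
  -- differentiability of the distortion in the base point is not needed.
  refine IsLocalMax.deriv_eq_zero ?_
  -- Near `t = 0` the line stays in the chart and off the zero section.
  have hopen : IsOpen {z : Rn n × Rn n | z.1 ∈ e.target ∧ z.2 ≠ 0} :=
    (e.open_target.preimage continuous_fst).inter (isOpen_ne.preimage continuous_snd)
  have hline : ContinuousAt (fun t : ℝ => (e x, w) + t • G) 0 := by fun_prop
  filter_upwards [hline.eventually (hopen.mem_nhds (by simpa using ⟨ha, hw⟩))] with t ht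
  simpa using hloc _ ht.1 ht.2

end Metric

end Finsler

theorem mainTheorem2 {n : ℕ} {M : Type*} [TopologicalSpace M] [T2Space M]
    [SecondCountableTopology M] [ConnectedSpace M] [ChartedSpace (Finsler.Rn n) M]
    [IsManifold (𝓡 n) ∞ M] (F : Finsler.FinslerMetric n M) (hF : F.IsHomogeneous) :
    F.HasIsotropicSCurvature ↔ F.HasVanishingSCurvature := by
  refine ⟨fun ⟨c, hc⟩ v hv => ?_, fun h => ⟨0, fun v hv => by simp [h v hv]⟩⟩
  obtain ⟨u, hu, hS⟩ := hF.exists_sCurvature_eq_zero v hv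
  rw [hc ⟨v.proj, u⟩ hu] at hS
  have hFu : F ⟨v.proj, u⟩ ≠ 0 := (F.pos' ⟨v.proj, u⟩ hu).ne'
  rw [hc v hv, (mul_eq_zero.1 hS).resolve_right hFu, zero_mul]
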